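/- **Proposition ($q$-$h$-polynomial of graph associahedra via tubings).** Let $n\ge 1$ and let $G$ be a simple graph on $[n]$, connected or not. *The polytope and its $q$-$h$-polynomial.* Let $\mathcal B$ be the collection of all nonempty $J\subseteq[n]$ such that the induced subgraph $G|_J$ is connected, together with the set $[n]$. Let $P_G=\sum_{I\in\mathcal B}y_I\,\Delta_I\subset\mathbb R^n$ be a Minkowski sum with arbitrary coefficients $y_I>0$, where $\Delta_I=\operatorname{conv}\{e_i: i\in I\}$; this is the graph associahedron of $G$. The normal cone of a face $F$ of $P_G$ is the set of linear functionals whose maximum on $P_G$ is attained at every point of $F$, and the normal fan is the set of the normal cones of all faces. A full-dimensional cone $\sigma$ of the normal fan defines a poset $Q_\sigma$ on $[n]$ by $i\le_{Q_\sigma} j$ if and only if $x_i\le x_j$ for all $x\in\sigma$, where $x_i$ denotes the value of the functional $x$ at $e_i$. A rank function on a poset $Q$ is a map $\rho$ to $\mathbb Z_{\ge 0}$ with $\rho(j)=\rho(i)+1$ whenever $i\lessdot_Q j$; the minimal rank function is the pointwise least one. Put $\operatorname{Des}(Q)=\{(i,j): i\lessdot_Q j,\ i>j\}$, $\operatorname{des}(Q)=|\operatorname{Des}(Q)|$,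 and $\operatorname{maj}(Q)=\sum_{(i,j)\in\operatorname{Des}(Q)}\rho(j)$ with $\rho$ the minimal rank function, and let $$h_G(t,q)=\sum_{\sigma}t^{\operatorname{des}(Q_\sigma)}q^{\operatorname{maj}(Q_\sigma)},$$ the sum being over the full-dimensional cones of the normal fan of $P_G$. *Tubings.* A tube of $G$ is a proper nonempty subset $A\subset[n]$ such that $G|_A$ is connected. A tubing of $G$ is a set $\chi$ of tubes such that any two incomparable $A_1,A_2\in\chi$ satisfy $A_1\cap A_2=\emptyset$ and $G|_{A_1\cup A_2}$ is not connected, and such that $\chi$ does not contain the vertex sets of all the connected components of $G$ (this is automatic if $G$ is connected). It is maximal if it is maximal under inclusion among tubings. *Statistics.* Let $\chi$ be a maximal tubing. For a tube $A\in\chi$, let $\alpha_A$ be the unique element of $A$ that lies in no tube of $\chi$ strictly contained in $A$, and let $\alpha_\ast$ be the unique element of $[n]$ that lies in no tube of $\chi$. Write $A\lessdot B$ if $A,B\in\chi$, $A\subsetneq B$, and no tube of $\chi$ lies strictly between $A$ and $B$. For $i\in[n]$ let $\nu_\chi(i)$ be the number of tubes of $\chi$ that contain $i$, and let $\operatorname{nest}(\chi)=\max_{i\in[n]}\nu_\chi(i)$.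 Define $$\operatorname{NestDes}(\chi)=\{(\alpha_A,\alpha_B): A\lessdot B,\ \alpha_A>\alpha_B\}\cup\{(\alpha_A,\alpha_\ast): A\in\chi \text{ maximal under inclusion in }\chi,\ \alpha_A>\alpha_\ast\},$$ $$\operatorname{nestDes}(\chi)=|\operatorname{NestDes}(\chi)|,\qquad \operatorname{nestMaj}(\chi)=\sum_{(a,b)\in\operatorname{NestDes}(\chi)}\bigl(\operatorname{nest}(\chi)-\nu_\chi(b)\bigr).$$ *Claim.* All these objects are well defined: for every maximal tubing $\chi$, each $\alpha_A$ and $\alpha_\ast$ exist and are unique; the normal fan of $P_G$ has finitely many full-dimensional cones $\sigma$; and each $Q_\sigma$ is a poset with a (pointwise) least rank function. For all coefficients $y_I>0$, $$h_G(t,q)=\sum_{\chi}t^{\operatorname{nestDes}(\chi)}q^{\operatorname{nestMaj}(\chi)},$$ where the sum is over all maximal tubings $\chi$ of $G$. -/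

import Mathlib

open scoped Pointwise

noncomputable section

namespace GraphAssoc

variable {n : ℕ}

/-! ### Normal fans of polytopes in `ℝⁿ` -/

/-- The faces of `P`: the subsets of `P` on which some linear functional is maximized. -/
def IsFace (P F : Set (Fin n → ℝ)) : Prop :=
  ∃ l : Module.Dual ℝ (Fin n → ℝ), F = {x ∈ P | ∀ y ∈ P, l y ≤ l x}

/-- The normal cone of `F` in `P`: the functionals whose maximum on `P` is attained at every
point of `F`. -/
def normalCone (P F : Set (Fin n → ℝ)) : Set (Module.Dual ℝ (Fin n → ℝ)) :=
  {l | ∀ x ∈ F, ∀ y ∈ P, l y ≤ l x}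

/-- The normal fan of `P`, the set of the normal cones of its faces. The cones are taken in
`(ℝⁿ)*` and not in its quotient by a space of functionals that are constant on `P`; every normal
cone is a union of cosets of that space, so this changes neither the set of full-dimensional
cones nor their posets. -/
def normalFan (P : Set (Fin n → ℝ)) : Set (Set (Module.Dual ℝ (Fin n → ℝ))) :=
  {σ | ∃ F, IsFace P F ∧ σ = normalCone P F}

/-- The full-dimensional cones of the normal fan. -/
def fullDimCones (P : Set (Fin n → ℝ)) : Set (Set (Module.Dual ℝ (Fin n → ℝ))) :=
  {σ ∈ normalFan P | affineSpan ℝ σ = ⊤}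

/-- The `i`-th coordinate of a functional. -/
def coord (l : Module.Dual ℝ (Fin n → ℝ)) (i : Fin n) : ℝ := l (Pi.single i 1)

theorem eq_of_coord_eq {σ : Set (Module.Dual ℝ (Fin n → ℝ))} (hσ : affineSpan ℝ σ = ⊤)
    {i j : Fin n} (h : ∀ l ∈ σ, coord l i = coord l j) : i = j := by
  by_contra hij
  let f : Module.Dual ℝ (Fin n → ℝ) →ₗ[ℝ] ℝ :=
    LinearMap.applyₗ (Pi.single i (1 : ℝ) - Pi.single j (1 : ℝ) : Fin n → ℝ)
  have hle : affineSpan ℝ σ ≤ (LinearMap.ker f).toAffineSubspace := by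
    refine affineSpan_le.2 fun l hl => ?_
    have := h l hl
    simp only [coord] at this
    simp [f, this]
  rw [hσ] at hle
  have hmem : (LinearMap.proj i : Module.Dual ℝ (Fin n → ℝ)) ∈
      (LinearMap.ker f).toAffineSubspace := hle (AffineSubspace.mem_top _ _ _)
  have h0 : f (LinearMap.proj i) = 0 := by simpa using hmem
  simp [f, hij] at h0

/-- The poset `Q_σ` on `[n]` of a full-dimensional cone `σ`: `i ≤ j` if and only if `x_i ≤ x_j`
for all `x ∈ σ`. -/
@[reducible]
def conePoset (σ : Set (Module.Dual ℝ (Fin n → ℝ))) (hσ : affineSpan ℝ σ = ⊤) :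
    PartialOrder (Fin n) where
  le i j := ∀ l ∈ σ, coord l i ≤ coord l j
  lt i j := (∀ l ∈ σ, coord l i ≤ coord l j) ∧ ¬ ∀ l ∈ σ, coord l j ≤ coord l i
  lt_iff_le_not_ge _ _ := Iff.rfl
  le_refl _ _ _ := le_rfl
  le_trans _ _ _ h₁ h₂ l hl := (h₁ l hl).trans (h₂ l hl)
  le_antisymm _ _ h₁ h₂ := eq_of_coord_eq hσ fun l hl => le_antisymm (h₁ l hl) (h₂ l hl)

/-! ### Descents and major index of a poset on `[n]`, the `q`-`h`-polynomial -/

/-- The covering relation of `Q`. -/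
def Covers (Q : PartialOrder (Fin n)) (i j : Fin n) : Prop :=
  @CovBy (Fin n) Q.toLT i j

/-- `Des(Q)`: the pairs `(i, j)` such that `j` covers `i` in `Q` and `i > j` as numbers. -/
def posetDes (Q : PartialOrder (Fin n)) : Finset (Fin n × Fin n) := by
  classical
  exact Finset.univ.filter fun p => Covers Q p.1 p.2 ∧ (p.2 : ℕ) < (p.1 : ℕ)

/-- Rank functions of `Q`. -/
def IsRankFunction (Q : PartialOrder (Fin n)) (ρ : Fin n → ℕ) : Prop :=
  ∀ i j, Covers Q i j → ρ j = ρ i + 1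

/-- The minimal rank function of a graded poset, i.e. the pointwise least one. (If the Hasse
diagram is connected, rank functions differ by constants and this is the one with minimum 0.) -/
def minRank (Q : PartialOrder (Fin n)) (i : Fin n) : ℕ :=
  sInf {m | ∃ ρ, IsRankFunction Q ρ ∧ ρ i = m}

/-- `maj(Q)`. -/
def posetMaj (Q : PartialOrder (Fin n)) : ℕ :=
  ∑ p ∈ posetDes Q, minRank Q p.2

/-- The `q`-`h`-polynomial of `P`, with `t = X 0` and `q = X 1`: the sum over the full-dimensional
cones `σ` of the normal fan of `t ^ des(Q_σ) * q ^ maj(Q_σ)`. -/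
def qhPolynomial (P : Set (Fin n → ℝ)) : MvPolynomial (Fin 2) ℤ :=
  ∑ᶠ σ : fullDimCones P,
    MvPolynomial.X 0 ^ (posetDes (conePoset σ.1 σ.2.2)).card *
      MvPolynomial.X 1 ^ posetMaj (conePoset σ.1 σ.2.2)

/-! ### Nestohedra and graph associahedra -/

/-- The simplex `Δ_I`, the convex hull of the `e_i` with `i ∈ I`. -/
def simplex (I : Finset (Fin n)) : Set (Fin n → ℝ) :=
  convexHull ℝ ((fun i => (Pi.single i 1 : Fin n → ℝ)) '' (I : Set (Fin n)))

/-- The Minkowski sum of the `y_I Δ_I` over `I ∈ B`. -/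
def nestohedron (B : Finset (Finset (Fin n))) (y : Finset (Fin n) → ℝ) : Set (Fin n → ℝ) :=
  ∑ I ∈ B, y I • simplex I

/-- `G|_I` is connected (in particular `I` is nonempty). -/
def InducesConnected (G : SimpleGraph (Fin n)) (I : Finset (Fin n)) : Prop :=
  (G.induce (I : Set (Fin n))).Connected

/-- The connected building set of `G`: the nonempty sets that induce a connected subgraph,
together with `[n]`. -/
def buildingSet (G : SimpleGraph (Fin n)) : Finset (Finset (Fin n)) := by
  classical
  exact insert Finset.univ (Finset.univ.filter fun I => InducesConnected G I)

/-- The graph associahedron of `G`, realized as the nestohedron of its connected building set. -/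
def graphAssociahedron (G : SimpleGraph (Fin n)) (y : Finset (Fin n) → ℝ) : Set (Fin n → ℝ) :=
  nestohedron (buildingSet G) y

/-! ### Tubings and nesting statistics -/

/-- A tube: a proper nonempty subset of `[n]` that induces a connected subgraph. -/
def IsTube (G : SimpleGraph (Fin n)) (A : Finset (Fin n)) : Prop :=
  A.Nonempty ∧ A ≠ Finset.univ ∧ InducesConnected G A

/-- A tubing: a set of tubes such that incomparable tubes are disjoint and non-adjacent (their
union does not induce a connected subgraph), and such that not all connected components of `G`
occur among the tubes. The last condition is automatic if `G` is connected. -/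
structure IsTubing (G : SimpleGraph (Fin n)) (χ : Finset (Finset (Fin n))) : Prop where
  isTube : ∀ A ∈ χ, IsTube G A
  nonintersecting : ∀ A ∈ χ, ∀ B ∈ χ, ¬ A ⊆ B → ¬ B ⊆ A → Disjoint A B
  nonadjacent : ∀ A ∈ χ, ∀ B ∈ χ, ¬ A ⊆ B → ¬ B ⊆ A → ¬ InducesConnected G (A ∪ B)
  components : ¬ ∀ c : G.ConnectedComponent, ∃ A ∈ χ, (A : Set (Fin n)) = c.supp

/-- The maximal tubings, i.e. those to which no tube can be added. -/
def maximalTubings (G : SimpleGraph (Fin n)) : Finset (Finset (Finset (Fin n))) := by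
  classical
  exact Finset.univ.filter fun χ => Maximal (IsTubing G) χ

/-- `a` is the distinguished element of the tube `A`: it lies in `A` and in no tube of `χ` that is
strictly contained in `A`. -/
def IsDistinguished (χ : Finset (Finset (Fin n))) (A : Finset (Fin n)) (a : Fin n) : Prop :=
  a ∈ A ∧ ∀ B ∈ χ, B ⊂ A → a ∉ B

/-- `a` is the element that lies in no tube of `χ`. -/
def IsUncovered (χ : Finset (Finset (Fin n))) (a : Fin n) : Prop :=
  ∀ A ∈ χ, a ∉ A

/-- `A ⋖ B`: both are in `χ`, `A ⊂ B`, and no tube of `χ` lies strictly between. -/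
def TubeCovers (χ : Finset (Finset (Fin n))) (A B : Finset (Fin n)) : Prop :=
  A ∈ χ ∧ B ∈ χ ∧ A ⊂ B ∧ ∀ C ∈ χ, ¬ (A ⊂ C ∧ C ⊂ B)

/-- The nesting index: the number of tubes containing `i`. -/
def nestingIndex (χ : Finset (Finset (Fin n))) (i : Fin n) : ℕ :=
  (χ.filter fun A => i ∈ A).card

/-- The nesting number: the maximum of the nesting indices. -/
def nestingNumber (χ : Finset (Finset (Fin n))) : ℕ :=
  Finset.univ.sup (nestingIndex χ)

/-- The nesting descent set. -/
def NestDes (χ : Finset (Finset (Fin n))) : Finset (Fin n × Fin n) := by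
  classical
  exact Finset.univ.filter fun p => p.2 < p.1 ∧
    ((∃ A B, TubeCovers χ A B ∧ IsDistinguished χ A p.1 ∧ IsDistinguished χ B p.2) ∨
      (∃ A ∈ χ, (∀ B ∈ χ, ¬ A ⊂ B) ∧ IsDistinguished χ A p.1 ∧ IsUncovered χ p.2))

/-- The nesting descent number. -/
def nestDes (χ : Finset (Finset (Fin n))) : ℕ := (NestDes χ).card

/-- The nesting major index. The subtraction never truncates, because `nestingNumber χ` is an
upper bound of the nesting indices. -/
def nestMaj (χ : Finset (Finset (Fin n))) : ℕ :=
  ∑ p ∈ NestDes χ, (nestingNumber χ - nestingIndex χ p.2)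

end GraphAssoc

end

noncomputable section

namespace GraphAssoc

variable {n : ℕ}

/-! ### Building sets and their trees -/

/-! Both sides of the formula are sums over the same finite set of trees.

A functional with pairwise distinct coordinates `x` is maximized on each summand `y_I Δ_I` at a
single point, given by the argmax of `x` on `I`. Its face of the polytope is therefore a vertex,
whose normal cone is cut out by the inequalities saying that each `I` in the building set has its
maximum at that argmax. These inequalities say that the functional preserves the order of a tree,
whose principal down-sets are the sets `lower B x i`. Every full-dimensional cone contains such an
`x`, so the full-dimensional cones are exactly the cones of these trees, and `Q_σ` is the tree order
(`mem_fullDimCones_iff`, `IsTreeMap.treeCone_le_iff`).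

The proper principal down-sets of a tree form a tubing with `n - 1` tubes, and every tubing is
contained in one of this kind; hence these are exactly the maximal tubings
(`mem_maximalTubings_iff`). A tree is recovered both from its cone and from its tubing.

Under this bijection `i` is the distinguished element of its down-set, the root is the uncovered
element, and cover relations of the tree are those of the tubing. The nesting index is the distance
to the root, so the least rank function is the nesting number minus the nesting index
(`isLeast_rank`). -/

/-- Connected building sets on `Fin n`. -/
structure IsBuilding (B : Finset (Finset (Fin n))) : Prop where
  univ_mem : Finset.univ ∈ B
  nonempty : ∀ I ∈ B, I.Nonempty
  singleton_mem : ∀ i, {i} ∈ B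
  union_mem : ∀ I ∈ B, ∀ J ∈ B, ∀ k ∈ I, k ∈ J → I ∪ J ∈ B

/-- `D` maps each element to its principal down-set in a `B`-tree, that is, a partial order in
which principal down-sets lie in `B` and each member of `B` has a greatest element. -/
structure IsTreeMap (B : Finset (Finset (Fin n))) (D : Fin n → Finset (Fin n)) : Prop where
  mem : ∀ i, D i ∈ B
  self_mem : ∀ i, i ∈ D i
  subset : ∀ i, ∀ j ∈ D i, D j ⊆ D i
  antisymm : ∀ i j, i ∈ D j → j ∈ D i → i = j
  cover : ∀ I ∈ B, ∃ i ∈ I, I ⊆ D i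

/-- The union of the members of `B` containing `i` on which `x` is maximal at `i`. -/
def lower (B : Finset (Finset (Fin n))) (x : Fin n → ℝ) (i : Fin n) : Finset (Fin n) := by
  classical
  exact Finset.univ.filter fun j => ∃ I ∈ B, i ∈ I ∧ j ∈ I ∧ ∀ k ∈ I, x k ≤ x i

theorem mem_lower {B : Finset (Finset (Fin n))} {x : Fin n → ℝ} {i j : Fin n} :
    j ∈ lower B x i ↔ ∃ I ∈ B, i ∈ I ∧ j ∈ I ∧ ∀ k ∈ I, x k ≤ x i := by
  simp [lower]

theorem subset_lower {B : Finset (Finset (Fin n))} {x : Fin n → ℝ} {i : Fin n}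
    {I : Finset (Fin n)} (hI : I ∈ B) (hi : i ∈ I) (h : ∀ k ∈ I, x k ≤ x i) : I ⊆ lower B x i :=
  fun _ hj => mem_lower.2 ⟨I, hI, hi, hj, h⟩

theorem le_of_mem_lower {B : Finset (Finset (Fin n))} {x : Fin n → ℝ} {i j : Fin n}
    (h : j ∈ lower B x i) : x j ≤ x i := by
  obtain ⟨I, -, -, hj, h⟩ := mem_lower.1 h
  exact h j hj

/-- The competing members of `B` all contain `i`, so they are closed under union, and one of largest
cardinality contains all the others. -/
theorem lower_mem {B : Finset (Finset (Fin n))} (hB : IsBuilding B) (x : Fin n → ℝ) (i : Fin n) :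
    lower B x i ∈ B := by
  classical
  obtain ⟨I, hI, hmax⟩ := Finset.exists_max_image
    (B.filter fun I => i ∈ I ∧ ∀ k ∈ I, x k ≤ x i) Finset.card
    ⟨{i}, by simpa using hB.singleton_mem i⟩
  simp only [Finset.mem_filter] at hI hmax
  obtain ⟨hI, hi, hle⟩ := hI
  suffices lower B x i = I by rwa [this]
  refine Finset.Subset.antisymm (fun j hj => ?_) (subset_lower hI hi hle)
  obtain ⟨J, hJ, hiJ, hj, hleJ⟩ := mem_lower.1 hj
  have hc := hmax (I ∪ J) ⟨hB.union_mem _ hI _ hJ i hi hiJ, by simp [hi], fun k hk =>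
    (Finset.mem_union.1 hk).elim (hle k) (hleJ k)⟩
  rw [Finset.eq_of_subset_of_card_le Finset.subset_union_left hc]
  exact Finset.mem_union_right _ hj

theorem isTreeMap_lower {B : Finset (Finset (Fin n))} (hB : IsBuilding B) {x : Fin n → ℝ}
    (hx : Function.Injective x) : IsTreeMap B (lower B x) where
  mem := lower_mem hB x
  self_mem i := mem_lower.2 ⟨{i}, hB.singleton_mem i, by simp⟩
  subset i j hj k hk := by
    obtain ⟨I, hI, hiI, hjI, h⟩ := mem_lower.1 hj
    obtain ⟨J, hJ, hjJ, hkJ, h'⟩ := mem_lower.1 hk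
    refine mem_lower.2 ⟨I ∪ J, hB.union_mem _ hI _ hJ j hjI hjJ, Finset.mem_union_left _ hiI,
      Finset.mem_union_right _ hkJ, fun l hl => ?_⟩
    exact (Finset.mem_union.1 hl).elim (h l) fun hl => (h' l hl).trans (h j hjI)
  antisymm i j hi hj := hx (le_antisymm (le_of_mem_lower hi) (le_of_mem_lower hj))
  cover I hI := by
    obtain ⟨i, hi, h⟩ := I.exists_max_image x (hB.nonempty I hI)
    exact ⟨i, hi, subset_lower hI hi h⟩

namespace IsTreeMap

variable {B : Finset (Finset (Fin n))} {D : Fin n → Finset (Fin n)}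

theorem injective (h : IsTreeMap B D) : Function.Injective D := fun i j hij =>
  h.antisymm i j (hij ▸ h.self_mem i) (hij ▸ h.self_mem j)

/-- Down-sets that meet have their union in `B`, and its greatest element lies in one of the two.
This is what makes the order a tree. -/
theorem mem_or_mem (h : IsTreeMap B D) (hB : IsBuilding B) {i j k : Fin n} (hi : k ∈ D i)
    (hj : k ∈ D j) : i ∈ D j ∨ j ∈ D i := by
  obtain ⟨l, hl, hsub⟩ := h.cover _ (hB.union_mem _ (h.mem i) _ (h.mem j) k hi hj)
  rcases Finset.mem_union.1 hl with hl | hl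
  · exact Or.inr (h.subset i l hl (hsub (Finset.mem_union_right _ (h.self_mem j))))
  · exact Or.inl (h.subset j l hl (hsub (Finset.mem_union_left _ (h.self_mem i))))

theorem exists_root (h : IsTreeMap B D) (hB : IsBuilding B) : ∃ r, D r = Finset.univ := by
  obtain ⟨r, -, hr⟩ := h.cover _ hB.univ_mem
  exact ⟨r, Finset.univ_subset_iff.1 hr⟩

theorem ssubset (h : IsTreeMap B D) {i j : Fin n} (hi : i ∈ D j) (hij : i ≠ j) : D i ⊂ D j :=
  (h.subset j i hi).ssubset_of_ne fun he => hij (h.injective he)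

end IsTreeMap

/-- The proper principal down-sets. -/
def tubesOf (D : Fin n → Finset (Fin n)) : Finset (Finset (Fin n)) :=
  (Finset.univ.image D).erase Finset.univ

theorem mem_tubesOf {D : Fin n → Finset (Fin n)} {A : Finset (Fin n)} :
    A ∈ tubesOf D ↔ A ≠ Finset.univ ∧ ∃ i, D i = A := by
  simp [tubesOf]

/-- The count does not depend on `D`; this is what later gives maximality of the tubing. -/
theorem IsTreeMap.card_tubesOf {B : Finset (Finset (Fin n))} {D : Fin n → Finset (Fin n)}
    (h : IsTreeMap B D) (hB : IsBuilding B) : (tubesOf D).card = n - 1 := by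
  obtain ⟨r, hr⟩ := h.exists_root hB
  rw [tubesOf, Finset.card_erase_of_mem (Finset.mem_image.2 ⟨r, Finset.mem_univ _, hr⟩),
    Finset.card_image_of_injective _ h.injective, Finset.card_univ, Fintype.card_fin]

theorem IsTreeMap.mem_iff {B : Finset (Finset (Fin n))} {D : Fin n → Finset (Fin n)}
    (h : IsTreeMap B D) {i j : Fin n} : j ∈ D i ↔ ∀ A ∈ tubesOf D, i ∈ A → j ∈ A := by
  refine ⟨fun hj A hA hi => ?_, fun hj => ?_⟩
  · obtain ⟨-, k, rfl⟩ := mem_tubesOf.1 hA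
    exact h.subset k i hi hj
  · by_cases hu : D i = Finset.univ
    · simp [hu]
    · exact hj (D i) (mem_tubesOf.2 ⟨hu, i, rfl⟩) (h.self_mem i)

theorem IsTreeMap.eq_of_tubesOf_eq {B : Finset (Finset (Fin n))} {D D' : Fin n → Finset (Fin n)}
    (h : IsTreeMap B D) (h' : IsTreeMap B D') (he : tubesOf D = tubesOf D') : D = D' := by
  funext i
  ext j
  rw [h.mem_iff, h'.mem_iff, he]

/-! ### Connectivity of induced subgraphs -/

theorem InducesConnected.nonempty {G : SimpleGraph (Fin n)} {I : Finset (Fin n)}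
    (h : InducesConnected G I) : I.Nonempty := by
  obtain ⟨⟨i, hi⟩⟩ := SimpleGraph.Connected.nonempty h
  exact ⟨i, hi⟩

theorem InducesConnected.union {G : SimpleGraph (Fin n)} {I J : Finset (Fin n)}
    (hI : InducesConnected G I) (hJ : InducesConnected G J) {k : Fin n} (hk : k ∈ I)
    (hk' : k ∈ J) : InducesConnected G (I ∪ J) := by
  rw [InducesConnected, Finset.coe_union]
  exact SimpleGraph.induce_union_connected hI.preconnected hJ.preconnected ⟨k, hk, hk'⟩

theorem InducesConnected.union_of_adj {G : SimpleGraph (Fin n)} {I J : Finset (Fin n)}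
    (hI : InducesConnected G I) (hJ : InducesConnected G J) {j k : Fin n} (hj : j ∈ I)
    (hk : k ∈ J) (hjk : G.Adj j k) : InducesConnected G (I ∪ J) := by
  rw [InducesConnected, Finset.coe_union]
  exact SimpleGraph.connected_induce_union hI.preconnected hJ.preconnected hj hk hjk

theorem inducesConnected_singleton (G : SimpleGraph (Fin n)) (i : Fin n) :
    InducesConnected G {i} := by
  rw [InducesConnected, Finset.coe_singleton]
  exact (SimpleGraph.connected_iff _).2
    ⟨fun a b => Subsingleton.elim a b ▸ SimpleGraph.Reachable.refl a, ⟨⟨i, rfl⟩⟩⟩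

theorem InducesConnected.reachable {G : SimpleGraph (Fin n)} {I : Finset (Fin n)}
    (hI : InducesConnected G I) {i j : Fin n} (hi : i ∈ I) (hj : j ∈ I) : G.Reachable i j :=
  (hI.preconnected ⟨i, hi⟩ ⟨j, hj⟩).map (SimpleGraph.Embedding.induce _).toHom

theorem InducesConnected.exists_adj {G : SimpleGraph (Fin n)} {I A : Finset (Fin n)}
    (hI : InducesConnected G I) {i j : Fin n} (hi : i ∈ I) (hj : j ∈ I) (hiA : i ∈ A)
    (hjA : j ∉ A) : ∃ u ∈ A, ∃ v ∈ I, v ∉ A ∧ G.Adj u v := by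
  obtain ⟨p⟩ := hI.preconnected ⟨i, hi⟩ ⟨j, hj⟩
  obtain ⟨d, -, hd, hd'⟩ := p.exists_boundary_dart {v | v.1 ∈ A} hiA hjA
  exact ⟨d.fst.1, hd, d.snd.1, d.snd.2, hd', d.adj⟩

theorem mem_buildingSet {G : SimpleGraph (Fin n)} {I : Finset (Fin n)} :
    I ∈ buildingSet G ↔ I = Finset.univ ∨ InducesConnected G I := by
  simp [buildingSet]

theorem isBuilding_buildingSet (hn : 0 < n) (G : SimpleGraph (Fin n)) :
    IsBuilding (buildingSet G) where
  univ_mem := mem_buildingSet.2 (Or.inl rfl)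
  nonempty I hI := by
    rcases mem_buildingSet.1 hI with rfl | h
    · exact ⟨⟨0, hn⟩, Finset.mem_univ _⟩
    · exact h.nonempty
  singleton_mem i := mem_buildingSet.2 (Or.inr (inducesConnected_singleton G i))
  union_mem I hI J hJ k hk hk' := by
    rcases mem_buildingSet.1 hI with rfl | hI'
    · rwa [Finset.union_eq_left.2 (Finset.subset_univ J)]
    rcases mem_buildingSet.1 hJ with rfl | hJ'
    · rwa [Finset.union_eq_right.2 (Finset.subset_univ I)]
    exact mem_buildingSet.2 (Or.inr (hI'.union hJ' hk hk'))

/-! ### Maximal tubings are the tubings of trees -/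

/-- A connected union of two down-sets would have a greatest element, making the two comparable. If
all components were tubes, the one through the root would contain the down-set of the root, which is
everything. -/
theorem isTubing_tubesOf {G : SimpleGraph (Fin n)} (hB : IsBuilding (buildingSet G))
    {D : Fin n → Finset (Fin n)} (h : IsTreeMap (buildingSet G) D) : IsTubing G (tubesOf D) where
  isTube A hA := by
    obtain ⟨hA, i, rfl⟩ := mem_tubesOf.1 hA
    exact ⟨⟨i, h.self_mem i⟩, hA, (mem_buildingSet.1 (h.mem i)).resolve_left hA⟩
  nonintersecting A hA A' hA' hle hle' := by
    obtain ⟨-, i, rfl⟩ := mem_tubesOf.1 hA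
    obtain ⟨-, j, rfl⟩ := mem_tubesOf.1 hA'
    refine Finset.disjoint_left.2 fun k hk hk' => ?_
    rcases h.mem_or_mem hB hk hk' with hij | hij
    · exact hle (h.subset _ _ hij)
    · exact hle' (h.subset _ _ hij)
  nonadjacent A hA A' hA' hle hle' hc := by
    obtain ⟨-, i, rfl⟩ := mem_tubesOf.1 hA
    obtain ⟨-, j, rfl⟩ := mem_tubesOf.1 hA'
    obtain ⟨k, hk, hsub⟩ := h.cover _ (mem_buildingSet.2 (Or.inr hc))
    rcases Finset.mem_union.1 hk with hk | hk
    · exact hle' (Finset.subset_union_right.trans (hsub.trans (h.subset _ _ hk)))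
    · exact hle (Finset.subset_union_left.trans (hsub.trans (h.subset _ _ hk)))
  components hc := by
    obtain ⟨r, hr⟩ := h.exists_root hB
    obtain ⟨A, hA, hAr⟩ := hc (G.connectedComponentMk r)
    obtain ⟨hA, i, rfl⟩ := mem_tubesOf.1 hA
    have hri : r ∈ D i := by
      rw [← Finset.mem_coe, hAr]
      exact SimpleGraph.ConnectedComponent.connectedComponentMk_mem
    exact hA (Finset.univ_subset_iff.1 (hr ▸ h.subset i r hri))

theorem IsTubing.subset_of_adj {G : SimpleGraph (Fin n)} {χ : Finset (Finset (Fin n))}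
    (h : IsTubing G χ) {A C : Finset (Fin n)} (hA : A ∈ χ) (hC : C ∈ χ) {j k : Fin n} (hj : j ∈ A)
    (hkA : k ∉ A) (hk : k ∈ C) (hjk : G.Adj j k) : A ⊆ C := by
  by_contra hAC
  exact h.nonadjacent A hA C hC hAC (fun hCA => hkA (hCA hk))
    ((h.isTube A hA).2.2.union_of_adj (h.isTube C hC).2.2 hj hk hjk)

/-- If every vertex were covered, a largest tube through `v` would be its whole component: the outer
end of an edge leaving it lies in a tube, which then contains it strictly by `subset_of_adj`. -/
theorem IsTubing.exists_isUncovered {G : SimpleGraph (Fin n)} {χ : Finset (Finset (Fin n))}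
    (h : IsTubing G χ) : ∃ r, IsUncovered χ r := by
  classical
  by_contra! hcov
  simp only [IsUncovered, not_forall, not_not] at hcov
  refine h.components fun c => ?_
  obtain ⟨v, rfl⟩ := c.exists_rep
  obtain ⟨A, hA, hmax⟩ := Finset.exists_max_image (χ.filter fun A => v ∈ A) Finset.card (by
    obtain ⟨A, hA, hv⟩ := hcov v
    exact ⟨A, by simp [hA, hv]⟩)
  simp only [Finset.mem_filter] at hA hmax
  refine ⟨A, hA.1, Set.Subset.antisymm (fun w hw => ?_) fun w hw => ?_⟩
  · exact SimpleGraph.ConnectedComponent.sound ((h.isTube A hA.1).2.2.reachable hw hA.2)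
  · by_contra hwA
    obtain ⟨p⟩ := (SimpleGraph.ConnectedComponent.exact hw).symm
    obtain ⟨d, -, hd, hd'⟩ := p.exists_boundary_dart (A : Set (Fin n)) hA.2 hwA
    obtain ⟨C, hC, hdC⟩ := hcov d.snd
    have hAC := h.subset_of_adj hA.1 hC hd hd' hdC d.adj
    rw [Finset.eq_of_subset_of_card_le hAC (hmax C ⟨hC, hAC hA.2⟩)] at hd'
    exact hd' hdC

theorem IsTubing.nestingIndex_lt_of_adj {G : SimpleGraph (Fin n)} {χ : Finset (Finset (Fin n))}
    (h : IsTubing G χ) {A : Finset (Fin n)} (hA : A ∈ χ) {a j k : Fin n} (ha : a ∈ A) (hj : j ∈ A)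
    (hkA : k ∉ A) (hjk : G.Adj j k) : nestingIndex χ k < nestingIndex χ a := by
  refine Finset.card_lt_card (Finset.ssubset_iff_of_subset (fun C hC => ?_) |>.2 ⟨A, ?_, ?_⟩)
  · simp only [Finset.mem_filter] at hC ⊢
    exact ⟨hC.1, h.subset_of_adj hA hC.1 hj hkA hC.2 hjk ha⟩
  · simp [hA, ha]
  · simp [hkA]

theorem IsUncovered.nestingIndex_eq_zero {χ : Finset (Finset (Fin n))} {r : Fin n}
    (h : IsUncovered χ r) : nestingIndex χ r = 0 := by
  rw [nestingIndex, Finset.card_eq_zero, Finset.filter_eq_empty_iff]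
  exact fun A hA => h A hA

theorem exists_injective_antitone (ν : Fin n → ℕ) (r : Fin n) (hr : ν r = 0) :
    ∃ x : Fin n → ℝ, Function.Injective x ∧ (∀ i, x i ≤ x r) ∧ ∀ i j, ν i < ν j → x j < x i := by
  -- `c` takes distinct values in `[0, n]` and breaks ties, while the weight `n + 1` lets `ν`
  -- dominate. The choice `c r = 0` puts `r` on top.
  let c : Fin n → ℕ := fun i => if i = r then 0 else i + 1
  let z : Fin n → ℕ := fun i => c i + (n + 1) * ν i
  have hc : ∀ i, c i < n + 1 := fun i => by
    simp only [c]
    split_ifs <;> omega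
  have hcr : c r = 0 := by simp [c]
  refine ⟨fun i => -(z i : ℝ), fun i j hij => ?_, fun i => ?_, fun i j hij => ?_⟩
  · have hz : z i = z j := by simpa using hij
    have hz' := congrArg (· % (n + 1)) hz
    simp only [z, Nat.add_mul_mod_self_left, Nat.mod_eq_of_lt (hc _)] at hz'
    simp only [c] at hz'
    split_ifs at hz' with h₁ h₂ h₂
    · rw [h₁, h₂]
    · ext; omega
  · have hzr : z r = 0 := by simp [z, hcr, hr]
    simp [hzr]
  · have hz : z i < z j := by
      have := Nat.mul_le_mul_left (n + 1) (Nat.succ_le_of_lt hij)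
      have := hc i
      simp only [z, Nat.mul_succ] at *
      omega
    simpa using hz

/-- Let `x` decrease as the nesting index grows. A connected set that contains the maximum point of
a tube `A` and leaves `A` meets a neighbour of `A`, whose nesting index is smaller and whose `x` is
thus larger. So `A` is the lower set of its maximum point. -/
theorem IsTubing.exists_subset_tubesOf {G : SimpleGraph (Fin n)} {χ : Finset (Finset (Fin n))}
    (h : IsTubing G χ) :
    ∃ x : Fin n → ℝ, Function.Injective x ∧ χ ⊆ tubesOf (lower (buildingSet G) x) := by
  obtain ⟨r, hr⟩ := h.exists_isUncovered
  obtain ⟨x, hx, hxr, hlt⟩ := exists_injective_antitone (nestingIndex χ) r hr.nestingIndex_eq_zero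
  refine ⟨x, hx, fun A hA => ?_⟩
  have hAt := h.isTube A hA
  obtain ⟨a, ha, hmax⟩ := A.exists_max_image x hAt.1
  refine mem_tubesOf.2 ⟨hAt.2.1, a, Finset.Subset.antisymm (fun k hk => ?_)
    (subset_lower (mem_buildingSet.2 (Or.inr hAt.2.2)) ha hmax)⟩
  obtain ⟨I, hI, haI, hkI, hle⟩ := mem_lower.1 hk
  by_contra hkA
  -- If `G` is disconnected, `[n]` belongs to the building set without being connected. Its maximum
  -- is at the uncovered element `r`, which cannot lie in `A`.
  rcases mem_buildingSet.1 hI with rfl | hI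
  · have : r = a := hx (le_antisymm (hle r (Finset.mem_univ _)) (hxr a))
    exact hr A hA (this ▸ ha)
  · obtain ⟨u, hu, v, hv, hvA, huv⟩ := hI.exists_adj haI hkI ha hkA
    exact (hle v hv).not_gt (hlt _ _ (h.nestingIndex_lt_of_adj hA ha hu hvA huv))

theorem mem_maximalTubings_iff {G : SimpleGraph (Fin n)} (hB : IsBuilding (buildingSet G))
    {χ : Finset (Finset (Fin n))} : χ ∈ maximalTubings G ↔
      ∃ x : Fin n → ℝ, Function.Injective x ∧ tubesOf (lower (buildingSet G) x) = χ := by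
  simp only [maximalTubings, Finset.mem_filter, Finset.mem_univ, true_and]
  constructor
  · intro h
    obtain ⟨x, hx, hsub⟩ := h.prop.exists_subset_tubesOf
    exact ⟨x, hx, (h.eq_of_le (isTubing_tubesOf hB (isTreeMap_lower hB hx)) hsub).symm⟩
  · rintro ⟨x, hx, rfl⟩
    refine ⟨isTubing_tubesOf hB (isTreeMap_lower hB hx), fun χ hχ hle => ?_⟩
    obtain ⟨x', hx', hsub⟩ := hχ.exists_subset_tubesOf
    have hc := (isTreeMap_lower hB hx').card_tubesOf hB
    rw [← (isTreeMap_lower hB hx).card_tubesOf hB] at hc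
    rw [Finset.eq_of_subset_of_card_le (hle.trans hsub) hc.le]
    exact hsub

/-! ### Cones of trees -/

/-- The functionals that are order preserving for the tree with principal down-sets `D`. -/
def treeCone (D : Fin n → Finset (Fin n)) : Set (Module.Dual ℝ (Fin n → ℝ)) :=
  {m | ∀ i, ∀ j ∈ D i, coord m j ≤ coord m i}

/-- The functional with given coordinates. -/
def ofCoord (x : Fin n → ℝ) : Module.Dual ℝ (Fin n → ℝ) :=
  ∑ i, x i • (LinearMap.proj i : (Fin n → ℝ) →ₗ[ℝ] ℝ)

@[simp]
theorem coord_ofCoord (x : Fin n → ℝ) : coord (ofCoord x) = x := by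
  funext i
  simp [coord, ofCoord, Pi.single_apply]

theorem dual_apply (l : Module.Dual ℝ (Fin n → ℝ)) (p : Fin n → ℝ) :
    l p = ∑ i, p i * coord l i := by
  rw [LinearMap.pi_apply_eq_sum_univ l p]
  refine Finset.sum_congr rfl fun i _ => ?_
  rw [smul_eq_mul, coord]
  congr 2
  ext j
  simp [Pi.single_apply, eq_comm]

theorem IsTreeMap.treeCone_le_iff {B : Finset (Finset (Fin n))} {D : Fin n → Finset (Fin n)}
    (h : IsTreeMap B D) {i j : Fin n} :
    (∀ m ∈ treeCone D, coord m j ≤ coord m i) ↔ j ∈ D i := by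
  classical
  refine ⟨fun hm => ?_, fun hj m hm => hm i j hj⟩
  by_contra hj
  -- The test functional is the indicator of the up-set of `j`.
  have := hm (ofCoord fun k => if j ∈ D k then 1 else 0) fun k l hl => by
    simp only [coord_ofCoord]
    split_ifs with h₁ h₂ <;> norm_num
    exact h₂ (h.subset k l hl h₁)
  simp only [coord_ofCoord, h.self_mem j, hj, if_true, if_false] at this
  norm_num at this

/-- The inequalities for `I = lower B x i` suffice, since `x` has its maximum on that set at `i`. -/
theorem mem_treeCone_lower_iff {B : Finset (Finset (Fin n))} (hB : IsBuilding B)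
    {x : Fin n → ℝ} (hx : Function.Injective x) {f : Finset (Fin n) → Fin n}
    (hf : ∀ I ∈ B, f I ∈ I ∧ ∀ i ∈ I, x i ≤ x (f I)) {m : Module.Dual ℝ (Fin n → ℝ)} :
    m ∈ treeCone (lower B x) ↔ ∀ I ∈ B, ∀ i ∈ I, coord m i ≤ coord m (f I) := by
  refine ⟨fun hm I hI i hi => hm _ i (subset_lower hI (hf I hI).1 (hf I hI).2 hi),
    fun hm i j hj => ?_⟩
  have hI := lower_mem hB x i
  have hfi : f (lower B x i) = i := hx (le_antisymm (le_of_mem_lower (hf _ hI).1)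
    ((hf _ hI).2 i ((isTreeMap_lower hB hx).self_mem i)))
  simpa only [hfi] using hm _ hI j hj

/-- For large `M` both `m + M x` and `M x` lie in the cone, because `x` satisfies the nontrivial
inequalities strictly; their difference is the arbitrary functional `m`. -/
theorem affineSpan_treeCone_lower (B : Finset (Finset (Fin n))) {x : Fin n → ℝ}
    (hx : Function.Injective x) : affineSpan ℝ (treeCone (lower B x)) = ⊤ := by
  have h0 : (0 : Module.Dual ℝ (Fin n → ℝ)) ∈ treeCone (lower B x) := fun i j _ => by
    simp [coord]
  rw [AffineSubspace.affineSpan_eq_top_iff_vectorSpan_eq_top_of_nonempty _ _ _ ⟨0, h0⟩,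
    vectorSpan_eq_span_vsub_set_right ℝ h0]
  simp only [vsub_eq_sub, sub_zero, Set.image_id']
  refine Submodule.eq_top_iff'.2 fun m => ?_
  have hex : ∀ p : Fin n × Fin n, ∃ N : ℕ, ∀ M : ℕ, N ≤ M → p.2 ∈ lower B x p.1 →
      coord m p.2 + M * x p.2 ≤ coord m p.1 + M * x p.1 := by
    rintro ⟨i, j⟩
    by_cases hj : j ∈ lower B x i
    · rcases (le_of_mem_lower hj).eq_or_lt with he | hlt
      · exact ⟨0, fun M _ _ => by simp [hx he]⟩
      · obtain ⟨N, hN⟩ := exists_nat_ge ((coord m j - coord m i) / (x i - x j))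
        refine ⟨N, fun M hM _ => ?_⟩
        have hM' : (N : ℝ) ≤ M := by exact_mod_cast hM
        have := (div_le_iff₀ (sub_pos.2 hlt)).1 (hN.trans hM')
        dsimp only
        linarith
    · exact ⟨0, fun _ _ h => absurd h hj⟩
  choose N hN using hex
  have hmem : ∀ a : ℝ, ∀ b : ℝ, 0 ≤ b → (∀ i, ∀ j ∈ lower B x i,
      a * coord m j + b * x j ≤ a * coord m i + b * x i) →
      a • m + b • ofCoord x ∈ treeCone (lower B x) := fun a b _ h i j hj => by
    have h₁ := congrFun (coord_ofCoord x) i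
    have h₂ := congrFun (coord_ofCoord x) j
    simp only [coord] at h h₁ h₂ ⊢
    simpa [h₁, h₂] using h i j hj
  let M : ℕ := Finset.univ.sup N
  have h₁ := hmem 1 M (Nat.cast_nonneg _) fun i j hj => by
    simpa using hN (i, j) M (Finset.le_sup (Finset.mem_univ (i, j))) hj
  have h₂ := hmem 0 M (Nat.cast_nonneg _) fun i j hj => by
    simpa using mul_le_mul_of_nonneg_left (le_of_mem_lower hj) (Nat.cast_nonneg M)
  simpa using Submodule.sub_mem _ (Submodule.subset_span h₁) (Submodule.subset_span h₂)

/-! ### Generic functionals in full-dimensional cones -/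

/-- The set lies in no hyperplane on which two coordinates agree. Pairs are separated one at a time
by a perturbation whose size avoids finitely many bad values. -/
theorem exists_coord_injective {σ : Set (Module.Dual ℝ (Fin n → ℝ))}
    (hσ : affineSpan ℝ σ = ⊤) (hadd : ∀ l ∈ σ, ∀ l' ∈ σ, ∀ ε : ℝ, 0 < ε → l + ε • l' ∈ σ) :
    ∃ l ∈ σ, Function.Injective (coord l) := by
  classical
  have key : ∀ S : Finset (Fin n × Fin n), (∀ p ∈ S, p.1 ≠ p.2) →
      ∃ l ∈ σ, ∀ p ∈ S, coord l p.1 ≠ coord l p.2 := by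
    intro S
    induction S using Finset.induction_on with
    | empty =>
      intro _
      rcases σ.eq_empty_or_nonempty with rfl | ⟨l, hl⟩
      · simp only [AffineSubspace.span_empty] at hσ
        exact absurd hσ bot_ne_top
      · exact ⟨l, hl, by simp⟩
    | insert p S _ ih =>
      intro hS
      obtain ⟨l, hl, hlS⟩ := ih fun q hq => hS q (Finset.mem_insert_of_mem hq)
      have hp := hS p (Finset.mem_insert_self _ _)
      obtain ⟨l', hl', hlp⟩ : ∃ l' ∈ σ, coord l' p.1 ≠ coord l' p.2 := by
        by_contra! hc
        exact hp (eq_of_coord_eq hσ hc)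
      obtain ⟨ε, hε, hεS⟩ := (Set.Ioi_infinite (0 : ℝ)).exists_notMem_finset
        ((insert p S).image fun q =>
          (coord l q.2 - coord l q.1) / (coord l' q.1 - coord l' q.2))
      refine ⟨l + ε • l', hadd l hl l' hl' ε hε, fun q hq he => ?_⟩
      have he' : coord l q.1 + ε * coord l' q.1 = coord l q.2 + ε * coord l' q.2 := by
        simpa [coord] using he
      by_cases hq' : coord l' q.1 = coord l' q.2
      · rcases Finset.mem_insert.1 hq with rfl | hqS
        · exact hlp hq'
        · rw [hq'] at he'
          exact hlS q hqS (add_right_cancel he')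
      · refine hεS (Finset.mem_image.2 ⟨q, hq, ?_⟩)
        rw [div_eq_iff (sub_ne_zero.2 hq')]
        linarith
  obtain ⟨l, hl, h⟩ := key (Finset.univ.filter fun p => p.1 ≠ p.2) (by simp)
  refine ⟨l, hl, fun i j hij => ?_⟩
  by_contra hne
  exact h (i, j) (by simpa using hne) hij

theorem normalCone_add_smul {P F : Set (Fin n → ℝ)} {l l' : Module.Dual ℝ (Fin n → ℝ)}
    (hl : l ∈ normalCone P F) (hl' : l' ∈ normalCone P F) {ε : ℝ} (hε : 0 < ε) :
    l + ε • l' ∈ normalCone P F := fun x hx y hy => by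
  have h₁ := hl x hx y hy
  have h₂ := mul_le_mul_of_nonneg_left (hl' x hx y hy) hε.le
  simpa using add_le_add h₁ h₂

/-! ### Vertices of nestohedra -/

theorem simplex_subset (I : Finset (Fin n)) :
    simplex I ⊆ {g | (∀ i, 0 ≤ g i) ∧ ∑ i, g i = 1 ∧ ∀ i, i ∉ I → g i = 0} := by
  refine convexHull_min ?_ ?_
  · rintro _ ⟨i, hi, rfl⟩
    refine ⟨fun j => ?_, by simp, fun j hj => ?_⟩
    · by_cases h : j = i <;> simp [h]
    · have : j ≠ i := fun h => hj (h ▸ hi)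
      simp [this]
  · rintro g ⟨hg, hg1, hgI⟩ g' ⟨hg', hg1', hgI'⟩ a b ha hb hab
    refine ⟨fun i => ?_, ?_, fun i hi => ?_⟩
    · exact add_nonneg (mul_nonneg ha (hg i)) (mul_nonneg hb (hg' i))
    · simp [Finset.sum_add_distrib, ← Finset.mul_sum, hg1, hg1', hab]
    · simp [hgI i hi, hgI' i hi]

theorem single_mem_simplex {I : Finset (Fin n)} {i : Fin n} (hi : i ∈ I) :
    (Pi.single i 1 : Fin n → ℝ) ∈ simplex I :=
  subset_convexHull ℝ _ ⟨i, hi, rfl⟩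

theorem apply_le_of_mem_simplex {I : Finset (Fin n)} {l : Module.Dual ℝ (Fin n → ℝ)} {a : Fin n}
    (h : ∀ i ∈ I, coord l i ≤ coord l a) {g : Fin n → ℝ} (hg : g ∈ simplex I) :
    l g ≤ coord l a := by
  have hsub : simplex I ⊆ {g | l g ≤ coord l a} :=
    convexHull_min (by rintro _ ⟨i, hi, rfl⟩; exact h i hi)
      (convex_halfSpace_le l.isLinear _)
  exact hsub hg

/-- The deficit `coord l a - l g` is a sum of nonnegative terms `g i * (coord l a - coord l i)`, so
each of them vanishes. -/
theorem eq_single_of_mem_simplex {I : Finset (Fin n)} {l : Module.Dual ℝ (Fin n → ℝ)} {a : Fin n}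
    (h : ∀ i ∈ I, i ≠ a → coord l i < coord l a) {g : Fin n → ℝ} (hg : g ∈ simplex I)
    (he : coord l a ≤ l g) : g = Pi.single a 1 := by
  obtain ⟨hg0, hg1, hgI⟩ := simplex_subset I hg
  have hterm : ∀ i ∈ Finset.univ, 0 ≤ g i * (coord l a - coord l i) := fun i _ => by
    by_cases hi : i ∈ I
    · rcases eq_or_ne i a with rfl | hia
      · simp
      · exact mul_nonneg (hg0 i) (sub_nonneg.2 (h i hi hia).le)
    · simp [hgI i hi]
  have hsum : ∑ i, g i * (coord l a - coord l i) = coord l a - l g := by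
    simp only [mul_sub, Finset.sum_sub_distrib, ← Finset.sum_mul, hg1, one_mul, dual_apply l g]
  have hzero := (Finset.sum_eq_zero_iff_of_nonneg hterm).1
    (le_antisymm (by linarith) (Finset.sum_nonneg hterm))
  have hg' : ∀ i, i ≠ a → g i = 0 := fun i hia => by
    by_cases hi : i ∈ I
    · exact (mul_eq_zero.1 (hzero i (Finset.mem_univ i))).resolve_right
        (sub_ne_zero.2 (h i hi hia).ne')
    · exact hgI i hi
  rw [Finset.sum_eq_single a (fun i _ => hg' i) (by simp)] at hg1
  ext i
  rcases eq_or_ne i a with rfl | hia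
  · simp [hg1]
  · simp [hg' i hia, hia]

/-- The sum of the `y I • e_{f I}`. -/
def vertexOf (B : Finset (Finset (Fin n))) (y : Finset (Fin n) → ℝ)
    (f : Finset (Fin n) → Fin n) : Fin n → ℝ :=
  ∑ I ∈ B, y I • (Pi.single (f I) 1 : Fin n → ℝ)

theorem apply_vertexOf (B : Finset (Finset (Fin n))) (y : Finset (Fin n) → ℝ)
    (f : Finset (Fin n) → Fin n) (l : Module.Dual ℝ (Fin n → ℝ)) :
    l (vertexOf B y f) = ∑ I ∈ B, y I * coord l (f I) := by
  simp [vertexOf, coord]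

theorem vertexOf_mem {B : Finset (Finset (Fin n))} (y : Finset (Fin n) → ℝ)
    {f : Finset (Fin n) → Fin n} (hf : ∀ I ∈ B, f I ∈ I) : vertexOf B y f ∈ nestohedron B y :=
  Set.finsetSum_mem_finsetSum _ _ _ fun I hI => Set.smul_mem_smul_set (single_mem_simplex (hf I hI))

theorem mem_nestohedron {B : Finset (Finset (Fin n))} {y : Finset (Fin n) → ℝ} {p : Fin n → ℝ}
    (hp : p ∈ nestohedron B y) :
    ∃ g : Finset (Fin n) → Fin n → ℝ, (∀ I ∈ B, g I ∈ simplex I) ∧ p = ∑ I ∈ B, y I • g I := by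
  obtain ⟨g, hg, rfl⟩ := (Set.mem_finsetSum _ _ _).1 hp
  choose! g' hg' using fun I (hI : I ∈ B) => Set.mem_smul_set.1 (hg hI)
  exact ⟨g', fun I hI => (hg' I hI).1, Finset.sum_congr rfl fun I hI => (hg' I hI).2.symm⟩

theorem apply_le_apply_vertexOf {B : Finset (Finset (Fin n))} {y : Finset (Fin n) → ℝ}
    (hy : ∀ I ∈ B, 0 < y I) {l : Module.Dual ℝ (Fin n → ℝ)} {f : Finset (Fin n) → Fin n}
    (hf : ∀ I ∈ B, ∀ i ∈ I, coord l i ≤ coord l (f I)) {p : Fin n → ℝ}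
    (hp : p ∈ nestohedron B y) : l p ≤ l (vertexOf B y f) := by
  obtain ⟨g, hg, rfl⟩ := mem_nestohedron hp
  rw [apply_vertexOf, map_sum]
  refine Finset.sum_le_sum fun I hI => ?_
  rw [map_smul, smul_eq_mul]
  exact mul_le_mul_of_nonneg_left (apply_le_of_mem_simplex (hf I hI) (hg I hI)) (hy I hI).le

theorem eq_vertexOf_of_le {B : Finset (Finset (Fin n))} {y : Finset (Fin n) → ℝ}
    (hy : ∀ I ∈ B, 0 < y I) {l : Module.Dual ℝ (Fin n → ℝ)} {f : Finset (Fin n) → Fin n}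
    (hf : ∀ I ∈ B, ∀ i ∈ I, i ≠ f I → coord l i < coord l (f I)) {p : Fin n → ℝ}
    (hp : p ∈ nestohedron B y) (hle : l (vertexOf B y f) ≤ l p) : p = vertexOf B y f := by
  obtain ⟨g, hg, rfl⟩ := mem_nestohedron hp
  have hterm : ∀ I ∈ B, y I * l (g I) ≤ y I * coord l (f I) := fun I hI =>
    mul_le_mul_of_nonneg_left (apply_le_of_mem_simplex (fun i hi => by
      rcases eq_or_ne i (f I) with rfl | h
      · exact le_rfl
      · exact (hf I hI i hi h).le) (hg I hI)) (hy I hI).le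
  rw [apply_vertexOf, map_sum] at hle
  simp only [map_smul, smul_eq_mul] at hle
  have heq := (Finset.sum_eq_sum_iff_of_le hterm).1 (le_antisymm (Finset.sum_le_sum hterm) hle)
  refine Finset.sum_congr rfl fun I hI => ?_
  rw [eq_single_of_mem_simplex (hf I hI) (hg I hI)
    (mul_left_cancel₀ (hy I hI).ne' (heq I hI)).ge]

theorem normalCone_vertexOf {B : Finset (Finset (Fin n))} (hB : IsBuilding B)
    {y : Finset (Fin n) → ℝ} (hy : ∀ I ∈ B, 0 < y I) {x : Fin n → ℝ}
    (hx : Function.Injective x) {f : Finset (Fin n) → Fin n}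
    (hf : ∀ I ∈ B, f I ∈ I ∧ ∀ i ∈ I, x i ≤ x (f I)) :
    normalCone (nestohedron B y) {vertexOf B y f} = treeCone (lower B x) := by
  classical
  ext m
  rw [mem_treeCone_lower_iff hB hx hf]
  refine ⟨fun hm I hI i hi => ?_, fun hm p hp q hq => ?_⟩
  -- Moving the chosen point of the single summand `I` to `i` leaves all other terms unchanged;
  -- since `y I > 0`, the comparison reduces to the inequality for `I`.
  · have h := hm _ rfl (vertexOf B y (Function.update f I i)) (vertexOf_mem y fun J hJ => by
      rcases eq_or_ne J I with rfl | hJI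
      · simpa using hi
      · simpa [hJI] using (hf J hJ).1)
    rw [apply_vertexOf, apply_vertexOf, ← Finset.add_sum_erase _ _ hI,
      ← Finset.add_sum_erase _ (fun I => y I * coord m (f I)) hI,
      Finset.sum_congr rfl (g := fun I => y I * coord m (f I)) fun J hJ => by
        rw [Function.update_of_ne (Finset.ne_of_mem_erase hJ)]] at h
    simpa [hy I hI] using h
  · rw [Set.mem_singleton_iff.1 hp]
    exact apply_le_apply_vertexOf hy hm hq

theorem exists_argmax {B : Finset (Finset (Fin n))} (hB : IsBuilding B) (x : Fin n → ℝ) :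
    ∃ f : Finset (Fin n) → Fin n, ∀ I ∈ B, f I ∈ I ∧ ∀ i ∈ I, x i ≤ x (f I) := by
  choose f hf using fun I : B => I.1.exists_max_image x (hB.nonempty I I.2)
  have : Nonempty (Fin n) := (hB.nonempty _ hB.univ_mem).to_type
  classical
  exact ⟨fun I => if h : I ∈ B then f ⟨I, h⟩ else Classical.arbitrary _, fun I hI => by
    simpa [hI] using hf ⟨I, hI⟩⟩

theorem face_eq_singleton {B : Finset (Finset (Fin n))} {y : Finset (Fin n) → ℝ}
    (hy : ∀ I ∈ B, 0 < y I) {l : Module.Dual ℝ (Fin n → ℝ)}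
    (hl : Function.Injective (coord l)) {f : Finset (Fin n) → Fin n}
    (hf : ∀ I ∈ B, f I ∈ I ∧ ∀ i ∈ I, coord l i ≤ coord l (f I)) :
    {p ∈ nestohedron B y | ∀ q ∈ nestohedron B y, l q ≤ l p} = {vertexOf B y f} := by
  have hv := vertexOf_mem y fun I hI => (hf I hI).1
  refine Set.Subset.antisymm (fun p hp => ?_) ?_
  · exact eq_vertexOf_of_le hy (fun I hI i hi hne => ((hf I hI).2 i hi).lt_of_ne
      (hl.ne hne)) hp.1 (hp.2 _ hv)
  · rintro _ rfl
    exact ⟨hv, fun q hq => apply_le_apply_vertexOf hy (fun I hI => (hf I hI).2) hq⟩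

theorem mem_fullDimCones_iff {B : Finset (Finset (Fin n))} (hB : IsBuilding B)
    {y : Finset (Fin n) → ℝ} (hy : ∀ I ∈ B, 0 < y I) {σ : Set (Module.Dual ℝ (Fin n → ℝ))} :
    σ ∈ fullDimCones (nestohedron B y) ↔
      ∃ x : Fin n → ℝ, Function.Injective x ∧ treeCone (lower B x) = σ := by
  constructor
  · rintro ⟨⟨F, ⟨l₀, hF⟩, rfl⟩, hspan⟩
    obtain ⟨l, hl, hinj⟩ := exists_coord_injective hspan fun l hl l' hl' ε hε =>
      normalCone_add_smul hl hl' hε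
    obtain ⟨f₀, hf₀⟩ := exists_argmax hB (coord l₀)
    have hv₀ : vertexOf B y f₀ ∈ F := by
      rw [hF]
      exact ⟨vertexOf_mem y fun I hI => (hf₀ I hI).1, fun q hq =>
        apply_le_apply_vertexOf hy (fun I hI => (hf₀ I hI).2) hq⟩
    obtain ⟨f, hf⟩ := exists_argmax hB (coord l)
    -- The generic `l` in the cone is maximal at every point of `F`, so `F` lies in the face of `l`,
    -- a single vertex.
    have hsub : F ⊆ {vertexOf B y f} := by
      rw [← face_eq_singleton hy hinj hf]
      exact fun p hp => ⟨(hF ▸ hp).1, hl p hp⟩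
    have hFe : F = {vertexOf B y f} := (Set.Nonempty.subset_singleton_iff ⟨_, hv₀⟩).1 hsub
    exact ⟨coord l, hinj, by rw [hFe, normalCone_vertexOf hB hy hinj hf]⟩
  · rintro ⟨x, hx, rfl⟩
    obtain ⟨f, hf⟩ := exists_argmax hB x
    refine ⟨⟨{vertexOf B y f}, ⟨ofCoord x, ?_⟩, (normalCone_vertexOf hB hy hx hf).symm⟩,
      affineSpan_treeCone_lower B hx⟩
    rw [face_eq_singleton hy (by simpa using hx) (by simpa using hf)]

/-! ### The nesting statistics of the tubing of a tree -/

namespace IsTreeMap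

variable {B : Finset (Finset (Fin n))} {D : Fin n → Finset (Fin n)}

theorem isDistinguished_iff (h : IsTreeMap B D) {i a : Fin n} :
    IsDistinguished (tubesOf D) (D i) a ↔ a = i := by
  refine ⟨fun ⟨ha, hlt⟩ => ?_, ?_⟩
  · by_contra hne
    have hss := h.ssubset ha hne
    refine hlt (D a) (mem_tubesOf.2 ⟨fun hu => ?_, a, rfl⟩) hss (h.self_mem a)
    exact hss.not_subset (hu ▸ Finset.subset_univ _)
  · rintro rfl
    refine ⟨h.self_mem a, fun A hA hss ha => ?_⟩
    obtain ⟨-, j, rfl⟩ := mem_tubesOf.1 hA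
    exact hss.not_subset (h.subset j a ha)

theorem isUncovered_iff (h : IsTreeMap B D) {r a : Fin n} (hr : D r = Finset.univ) :
    IsUncovered (tubesOf D) a ↔ a = r := by
  refine ⟨fun ha => h.injective ?_, ?_⟩
  · by_contra hne
    exact ha (D a) (mem_tubesOf.2 ⟨hr ▸ hne, a, rfl⟩) (h.self_mem a)
  · rintro rfl A hA ha
    obtain ⟨hA, j, rfl⟩ := mem_tubesOf.1 hA
    exact hA (Finset.univ_subset_iff.1 (hr ▸ h.subset j a ha))

variable {Q : PartialOrder (Fin n)}

theorem covers_iff (h : IsTreeMap B D) (hQ : ∀ i j, Q.le i j ↔ i ∈ D j) {i j : Fin n} :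
    Covers Q i j ↔ D i ⊂ D j ∧ ∀ k, ¬ (D i ⊂ D k ∧ D k ⊂ D j) := by
  have hlt : ∀ i j, Q.lt i j ↔ D i ⊂ D j := fun i j => by
    have hle : ∀ i j, Q.le i j ↔ D i ⊆ D j := fun i j =>
      (hQ i j).trans ⟨h.subset j i, fun hs => hs (h.self_mem i)⟩
    rw [Q.lt_iff_le_not_ge, hle, hle]
    rfl
  simp only [Covers, CovBy]
  refine and_congr (hlt i j) ⟨fun hc k hk => ?_, fun hc k hik hkj => ?_⟩
  · exact hc ((hlt i k).2 hk.1) ((hlt k j).2 hk.2)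
  · exact hc k ⟨(hlt i k).1 hik, (hlt k j).1 hkj⟩

theorem exists_covers (h : IsTreeMap B D) (hB : IsBuilding B)
    (hQ : ∀ i j, Q.le i j ↔ i ∈ D j) {i : Fin n} (hi : D i ≠ Finset.univ) :
    ∃ j, Covers Q i j := by
  obtain ⟨r, hr⟩ := h.exists_root hB
  obtain ⟨j, hj, hmin⟩ := Finset.exists_min_image (Finset.univ.filter fun j => D i ⊂ D j)
    (fun j => (D j).card)
    ⟨r, by simpa [hr, Finset.ssubset_univ_iff] using hi⟩
  simp only [Finset.mem_filter, Finset.mem_univ, true_and] at hj hmin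
  exact ⟨j, (h.covers_iff hQ).2 ⟨hj, fun k hk => (Finset.card_lt_card hk.2).not_ge (hmin k hk.1)⟩⟩

/-- The tubes through `i` are those through `j` together with `D i`: a tube through `i` but not `j`
lies strictly inside `D j`, hence equals `D i`. -/
theorem nestingIndex_of_covers (h : IsTreeMap B D) (hB : IsBuilding B)
    (hQ : ∀ i j, Q.le i j ↔ i ∈ D j) {i j : Fin n} (hij : Covers Q i j) :
    nestingIndex (tubesOf D) i = nestingIndex (tubesOf D) j + 1 := by
  classical
  obtain ⟨hss, hc⟩ := (h.covers_iff hQ).1 hij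
  have hi : D i ∈ tubesOf D :=
    mem_tubesOf.2 ⟨fun hu => hss.not_subset (hu ▸ Finset.subset_univ _), i, rfl⟩
  have hj : j ∉ D i := fun hj => hss.not_subset (h.subset i j hj)
  rw [nestingIndex, nestingIndex, ← Finset.card_insert_of_notMem (a := D i) (by simp [hj])]
  congr 1
  ext A
  simp only [Finset.mem_filter, Finset.mem_insert]
  constructor
  · rintro ⟨hA, hiA⟩
    obtain ⟨-, k, rfl⟩ := mem_tubesOf.1 hA
    by_cases hjk : j ∈ D k
    · exact Or.inr ⟨hA, hjk⟩
    · have hkj := (h.mem_or_mem hB hiA (hss.1 (h.self_mem i))).resolve_right hjk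
      have hne : k ≠ j := fun he => hjk (he ▸ h.self_mem j)
      refine Or.inl (by_contra fun hki => hc k ⟨h.ssubset hiA fun he => hki (he ▸ rfl),
        h.ssubset hkj hne⟩)
  · rintro (rfl | ⟨hA, hjA⟩)
    · exact ⟨hi, h.self_mem i⟩
    · obtain ⟨-, k, rfl⟩ := mem_tubesOf.1 hA
      exact ⟨hA, h.subset k j hjA (hss.1 (h.self_mem i))⟩

theorem rank_add_nestingIndex (h : IsTreeMap B D) (hB : IsBuilding B)
    (hQ : ∀ i j, Q.le i j ↔ i ∈ D j) {ρ : Fin n → ℕ} (hρ : IsRankFunction Q ρ) {r : Fin n}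
    (hr : D r = Finset.univ) (i : Fin n) : ρ i + nestingIndex (tubesOf D) i = ρ r := by
  induction hk : nestingIndex (tubesOf D) i generalizing i with
  | zero =>
    by_cases hi : D i = Finset.univ
    · rw [h.injective (hi.trans hr.symm), add_zero]
    · obtain ⟨j, hj⟩ := h.exists_covers hB hQ hi
      have := h.nestingIndex_of_covers hB hQ hj
      omega
  | succ k ih =>
    by_cases hi : D i = Finset.univ
    · have hz := ((h.isUncovered_iff hi).2 rfl).nestingIndex_eq_zero
      omega
    · obtain ⟨j, hj⟩ := h.exists_covers hB hQ hi
      have h₁ := h.nestingIndex_of_covers hB hQ hj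
      have h₂ := hρ i j hj
      have h₃ := ih j (by omega)
      omega

theorem nestingIndex_le (χ : Finset (Finset (Fin n))) (i : Fin n) :
    nestingIndex χ i ≤ nestingNumber χ :=
  Finset.le_sup (f := nestingIndex χ) (Finset.mem_univ i)

/-- Along the path to the root, `ρ i` is forced to be `ρ r` minus the nesting index of `i`.
Nonnegativity at a most deeply nested element gives `ρ r` at least the nesting number. -/
theorem isLeast_rank (h : IsTreeMap B D) (hB : IsBuilding B)
    (hQ : ∀ i j, Q.le i j ↔ i ∈ D j) :
    IsLeast {ρ | IsRankFunction Q ρ}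
      fun i => nestingNumber (tubesOf D) - nestingIndex (tubesOf D) i := by
  refine ⟨fun i j hij => ?_, fun ρ hρ i => ?_⟩
  · have h₁ := h.nestingIndex_of_covers hB hQ hij
    have h₂ := nestingIndex_le (tubesOf D) i
    dsimp only
    omega
  · obtain ⟨r, hr⟩ := h.exists_root hB
    have hle : nestingNumber (tubesOf D) ≤ ρ r := Finset.sup_le fun j _ =>
      (Nat.le_add_left _ _).trans (h.rank_add_nestingIndex hB hQ hρ hr j).le
    have := h.rank_add_nestingIndex hB hQ hρ hr i
    dsimp only
    omega

theorem minRank_eq_of_isLeast {ρ : Fin n → ℕ} (hρ : IsLeast {ρ | IsRankFunction Q ρ} ρ) :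
    minRank Q = ρ := by
  funext i
  refine IsLeast.csInf_eq ⟨⟨ρ, hρ.1, rfl⟩, ?_⟩
  rintro _ ⟨ρ', hρ', rfl⟩
  exact hρ.2 hρ' i

/-- The two clauses of `NestDes` correspond to covers by a non-root and by the root, the down-set of
the root being the one that is not a tube. -/
theorem posetDes_eq (h : IsTreeMap B D) (hB : IsBuilding B)
    (hQ : ∀ i j, Q.le i j ↔ i ∈ D j) : posetDes Q = NestDes (tubesOf D) := by
  obtain ⟨r, hr⟩ := h.exists_root hB
  ext ⟨i, j⟩
  simp only [posetDes, NestDes, Finset.mem_filter, Finset.mem_univ, true_and, Fin.val_fin_lt]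
  rw [and_comm, h.covers_iff hQ, h.isUncovered_iff hr]
  refine and_congr_right fun _ => ⟨fun ⟨hss, hc⟩ => ?_, ?_⟩
  · have hi : D i ∈ tubesOf D :=
      mem_tubesOf.2 ⟨fun hu => hss.not_subset (hu ▸ Finset.subset_univ _), i, rfl⟩
    by_cases hj : D j = Finset.univ
    · refine Or.inr ⟨D i, hi, fun C hC hiC => ?_, h.isDistinguished_iff.2 rfl,
        h.injective (hj.trans hr.symm)⟩
      obtain ⟨hC, k, rfl⟩ := mem_tubesOf.1 hC
      exact hc k ⟨hiC, by rwa [hj, Finset.ssubset_univ_iff]⟩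
    · refine Or.inl ⟨D i, D j, ⟨hi, mem_tubesOf.2 ⟨hj, j, rfl⟩, hss, fun C hC => ?_⟩,
        h.isDistinguished_iff.2 rfl, h.isDistinguished_iff.2 rfl⟩
      obtain ⟨-, k, rfl⟩ := mem_tubesOf.1 hC
      exact hc k
  · rintro (⟨A, C, ⟨hA, hC, hss, hc⟩, hi, hj⟩ | ⟨A, hA, hc, hi, rfl⟩)
    · obtain ⟨-, i', rfl⟩ := mem_tubesOf.1 hA
      obtain ⟨hC, j', rfl⟩ := mem_tubesOf.1 hC
      obtain rfl := h.isDistinguished_iff.1 hi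
      obtain rfl := h.isDistinguished_iff.1 hj
      refine ⟨hss, fun k hk => hc (D k) (mem_tubesOf.2 ⟨fun hu => ?_, k, rfl⟩) hk⟩
      exact hk.2.not_subset (hu ▸ Finset.subset_univ _)
    · obtain ⟨hA, i', rfl⟩ := mem_tubesOf.1 hA
      obtain rfl := h.isDistinguished_iff.1 hi
      refine ⟨by rwa [hr, Finset.ssubset_univ_iff], fun k hk => ?_⟩
      refine hc (D k) (mem_tubesOf.2 ⟨fun hu => ?_, k, rfl⟩) hk.1
      exact hk.2.not_subset (hu ▸ Finset.subset_univ _)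

theorem posetMaj_eq (h : IsTreeMap B D) (hB : IsBuilding B)
    (hQ : ∀ i j, Q.le i j ↔ i ∈ D j) : posetMaj Q = nestMaj (tubesOf D) := by
  rw [posetMaj, nestMaj, h.posetDes_eq hB hQ, minRank_eq_of_isLeast (h.isLeast_rank hB hQ)]

theorem eq_of_treeCone_eq {D' : Fin n → Finset (Fin n)} (h : IsTreeMap B D)
    (h' : IsTreeMap B D') (he : treeCone D = treeCone D') : D = D' := by
  funext i
  ext j
  rw [← h.treeCone_le_iff, ← h'.treeCone_le_iff, he]

end IsTreeMap

end GraphAssoc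

end

theorem mainTheorem6 (n : ℕ) (hn : 0 < n) (G : SimpleGraph (Fin n))
    (y : Finset (Fin n) → ℝ) (hy : ∀ I ∈ GraphAssoc.buildingSet G, 0 < y I) :
    -- the distinguished elements of a maximal tubing are well defined
    (∀ χ ∈ GraphAssoc.maximalTubings G,
      (∀ A ∈ χ, ∃! a, GraphAssoc.IsDistinguished χ A a) ∧
        ∃! a, GraphAssoc.IsUncovered χ a) ∧
    -- the `q`-`h`-polynomial is well defined: the sum is finite and the posets are graded
    (GraphAssoc.fullDimCones (GraphAssoc.graphAssociahedron G y)).Finite ∧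
    (∀ σ : GraphAssoc.fullDimCones (GraphAssoc.graphAssociahedron G y),
      IsLeast {ρ | GraphAssoc.IsRankFunction (GraphAssoc.conePoset σ.1 σ.2.2) ρ}
        (GraphAssoc.minRank (GraphAssoc.conePoset σ.1 σ.2.2))) ∧
    -- the formula
    GraphAssoc.qhPolynomial (GraphAssoc.graphAssociahedron G y) =
      ∑ χ ∈ GraphAssoc.maximalTubings G,
        (MvPolynomial.X 0 : MvPolynomial (Fin 2) ℤ) ^ GraphAssoc.nestDes χ *
          MvPolynomial.X 1 ^ GraphAssoc.nestMaj χ := by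
  open GraphAssoc in
  have hB := isBuilding_buildingSet hn G
  have hcones : ∀ σ, σ ∈ fullDimCones (graphAssociahedron G y) ↔ _ := fun σ =>
    mem_fullDimCones_iff hB hy (σ := σ)
  -- `T` is the set of trees indexing both sums; `φ` and `ψ` send a tree to its cone and to its
  -- tubing.
  let T := {D : Fin n → Finset (Fin n) //
    ∃ x : Fin n → ℝ, Function.Injective x ∧ lower (buildingSet G) x = D}
  have hT : ∀ D : T, IsTreeMap (buildingSet G) D.1 := by
    rintro ⟨_, x, hx, rfl⟩
    exact isTreeMap_lower hB hx
  let φ : T → fullDimCones (graphAssociahedron G y) := fun D =>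
    ⟨treeCone D.1, (hcones _).2 (D.2.imp fun x hx => ⟨hx.1, congrArg treeCone hx.2⟩)⟩
  let ψ : T → maximalTubings G := fun D =>
    ⟨tubesOf D.1, (mem_maximalTubings_iff hB).2
      (D.2.imp fun x hx => ⟨hx.1, congrArg tubesOf hx.2⟩)⟩
  have hφ : Function.Bijective φ := by
    refine ⟨fun D D' he => Subtype.ext ((hT D).eq_of_treeCone_eq (hT D') (congrArg (·.1) he)), ?_⟩
    rintro ⟨σ, hσ⟩
    obtain ⟨x, hx, rfl⟩ := (hcones σ).1 hσ
    exact ⟨⟨_, x, hx, rfl⟩, rfl⟩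
  have hψ : Function.Bijective ψ := by
    refine ⟨fun D D' he => Subtype.ext ((hT D).eq_of_tubesOf_eq (hT D') (congrArg (·.1) he)), ?_⟩
    rintro ⟨χ, hχ⟩
    obtain ⟨x, hx, rfl⟩ := (mem_maximalTubings_iff hB).1 hχ
    exact ⟨⟨_, x, hx, rfl⟩, rfl⟩
  have hQ : ∀ D : T, ∀ i j, (conePoset (φ D).1 (φ D).2.2).le i j ↔ i ∈ D.1 j :=
    fun D i j => (hT D).treeCone_le_iff
  refine ⟨fun χ hχ => ?_, ?_, fun σ => ?_, ?_⟩
  · obtain ⟨D, hD⟩ := hψ.2 ⟨χ, hχ⟩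
    obtain rfl : tubesOf D.1 = χ := congrArg (·.1) hD
    obtain ⟨r, hr⟩ := (hT D).exists_root hB
    refine ⟨fun A hA => ?_, r, ((hT D).isUncovered_iff hr).2 rfl,
      fun a => ((hT D).isUncovered_iff hr).1⟩
    obtain ⟨-, i, rfl⟩ := mem_tubesOf.1 hA
    exact ⟨i, (hT D).isDistinguished_iff.2 rfl, fun a => (hT D).isDistinguished_iff.1⟩
  · exact Set.finite_coe_iff.1 (Finite.of_surjective φ hφ.2)
  · obtain ⟨D, rfl⟩ := hφ.2 σ
    have hl := (hT D).isLeast_rank (Q := conePoset (φ D).1 (φ D).2.2) hB (hQ D)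
    rwa [IsTreeMap.minRank_eq_of_isLeast hl]
  · rw [qhPolynomial, ← Finset.sum_coe_sort, ← finsum_eq_sum_of_fintype,
      ← finsum_comp _ hφ, ← finsum_comp _ hψ]
    refine finsum_congr fun D => ?_
    rw [(hT D).posetDes_eq (Q := conePoset (φ D).1 (φ D).2.2) hB (hQ D),
      (hT D).posetMaj_eq (Q := conePoset (φ D).1 (φ D).2.2) hB (hQ D)]
    rfl
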